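/- Let $Y\hookrightarrow(\mathbb C^2,0)$ be a plane curve singularity, that is, a reduced formal germ of dimension one, given by a radical ideal $I_Y\subset\mathbb C[[x,y]]$ with $\dim \mathbb C[[x,y]]/I_Y=1$. Suppose that no branch of $Y$ (no irreducible component of $Y$) is contained in the union $Z(xy)$ of the coordinate axes. A parametrized arc contained in $Y$ is a pair $(x(t),y(t))$ of series in $t\,\mathbb C[[t]]$ such that $g(x(t),y(t))=0$ for all $g\in I_Y$. If $x(t)=x_pt^p+\cdots$ and $y(t)=y_qt^q+\cdots$ with $x_p\neq 0$ and $y_q\neq 0$ (so $p,q>0$), then $(p,q)$ is its pair of initial exponents. Only finitely many real numbers occur as quotients $q/p$, where $(p,q)$ is the pair of initial exponents of a parametrized arc contained in $Y$ with both components non-zero. Moreover $Y$ has a defining series, that is, a series $f\in\mathbb C[[x,y]]$ with $I_Y=(f)$; and for every such $f$, those quotients are exactly the slopes of the rays orthogonal to the compact edges of the Newton polygon $\mathcal N(Y)=\mathcal N(f)$. Here $\mathcal N(f)\subset\mathbb R^2$ is the convex hull of $\operatorname{supp}f+\mathbb R_{\ge 0}^2$, where $\operatorname{supp} f$ is the set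 of the exponents $(\alpha,\beta)$ of the monomials $x^\alpha y^\beta$ with non-zero coefficient in $f$. A compact edge is a compact one-dimensional face of $\mathcal N(f)$. A ray $\mathbb R_{\ge0}(a,b)$ with $(a,b)\in\mathbb R_{\ge0}^2\smallsetminus\{0\}$ is orthogonal to an edge if $a\alpha+b\beta$ is constant for $(\alpha,\beta)$ in the edge, and its slope is $b/a$ if $a\neq 0$. -/

import Mathlib

/-- A plane curve singularity: a reduced formal germ of dimension one in `(ℂ², 0)`, given by its
ideal in `ℂ⟦x, y⟧`, where `x = X 0` and `y = X 1`. -/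
structure PlaneCurveSingularity where
  /-- the ideal of the germ -/
  ideal : Ideal (MvPowerSeries (Fin 2) ℂ)
  isRadical : ideal.IsRadical
  dim_eq_one : ringKrullDim (MvPowerSeries (Fin 2) ℂ ⧸ ideal) = 1

namespace PlaneCurveSingularity

/-- No branch (irreducible component) of `Y` is contained in the union `Z(xy)` of the coordinate
axes. The branches correspond to the minimal primes over the ideal of `Y`. -/
def NoBranchInAxes (Y : PlaneCurveSingularity) : Prop :=
  ∀ P ∈ Y.ideal.minimalPrimes,
    (MvPowerSeries.X 0 * MvPowerSeries.X 1 : MvPowerSeries (Fin 2) ℂ) ∉ P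

/-- `f` is a defining series of `Y`, that is, `Y = Z(f)`. -/
def IsDefiningSeries (Y : PlaneCurveSingularity) (f : MvPowerSeries (Fin 2) ℂ) : Prop :=
  Y.ideal = Ideal.span {f}

/-- `(x(t), y(t))` is a parametrized (formal) arc through the origin contained in `Y`. The
conditions on the constant coefficients make the substitution `g(x(t), y(t))` meaningful. -/
structure IsArc (Y : PlaneCurveSingularity) (x y : PowerSeries ℂ) : Prop where
  constantCoeff_fst : PowerSeries.constantCoeff x = 0
  constantCoeff_snd : PowerSeries.constantCoeff y = 0
  subst_eq_zero : ∀ g ∈ Y.ideal,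
    MvPowerSeries.subst (![x, y] : Fin 2 → MvPowerSeries Unit ℂ) g = 0

/-- The quotients `q / p`, for `(p, q)` the pair of initial exponents of an arc
`t ↦ (x_p t ^ p + ⋯, y_q t ^ q + ⋯)`, `x_p ≠ 0`, `y_q ≠ 0`, contained in `Y`. Both `p` and `q`
are positive because the constant coefficients vanish. -/
def initialExponentRatios (Y : PlaneCurveSingularity) : Set ℝ :=
  {s | ∃ (x y : PowerSeries ℂ) (p q : ℕ), Y.IsArc x y ∧ x.order = p ∧ y.order = q ∧
    s = (q : ℝ) / (p : ℝ)}

end PlaneCurveSingularity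

/-- The Newton polygon of a series `f`: the convex hull of `supp f + ℝ²_{≥ 0}`. -/
def newtonPolygon (f : MvPowerSeries (Fin 2) ℂ) : Set (ℝ × ℝ) :=
  convexHull ℝ {v | ∃ d : Fin 2 →₀ ℕ, MvPowerSeries.coeff d f ≠ 0 ∧
    (d 0 : ℝ) ≤ v.1 ∧ (d 1 : ℝ) ≤ v.2}

/-- `E` is a compact edge of the convex set `N`: a compact face of dimension one. -/
structure IsCompactEdge (N E : Set (ℝ × ℝ)) : Prop where
  isExposed : IsExposed ℝ N E
  isCompact : IsCompact E
  finrank_eq_one : Module.finrank ℝ (vectorSpan ℝ E) = 1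

/-- The weight vector `w` (hence the ray spanned by it) is orthogonal to `E`, for the pairing
`(p, q) · (α, β) = p α + q β` between weights and exponents. -/
def IsOrthogonalTo (w : ℝ × ℝ) (E : Set (ℝ × ℝ)) : Prop :=
  ∀ a ∈ E, ∀ b ∈ E, w.1 * (a.1 - b.1) + w.2 * (a.2 - b.2) = 0

/-- The slopes of the rays of the weight quadrant `ℝ²_{≥ 0}` orthogonal to the compact edges of
`N`. The ray spanned by `w ≠ 0` has slope `s` when `w.2 = s * w.1` (a vertical ray has none). -/
def orthogonalRaySlopes (N : Set (ℝ × ℝ)) : Set ℝ :=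
  {s | ∃ (E : Set (ℝ × ℝ)) (w : ℝ × ℝ), IsCompactEdge N E ∧ w ≠ 0 ∧ 0 ≤ w.1 ∧ 0 ≤ w.2 ∧
    IsOrthogonalTo w E ∧ w.2 = s * w.1}

/-! ### Weierstrass division and preparation over `K⟦X⟧`. -/

namespace PowerSeries

open scoped Polynomial

variable {K : Type*} [Field K]

/-! Both sides are compared with `newtonSlopes f`: the `s > 0` for which the weight `α + sβ` is
minimal at two or more exponents of `f`.

Arcs give Newton slopes (`div_mem_newtonSlopes_of_subst_eq_zero`): on an arc with initial exponents
`(p, q)` the monomial `x^α y^β` has order `pα + qβ`, so a unique minimum could not cancel.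
Conversely, `x ∤ f`, so Weierstrass preparation turns `f` into a unit times a polynomial `w` in `y`
over `ℂ⟦x⟧`; the unit does not affect slopes. For a slope `q/p`, write `w(t^p, t^q Z) = t^N Q(Z)`
with `N` the minimal weight. Modulo `t`, `Q` has two nonzero coefficients, hence a root `c ≠ 0`.
Preparation of `Q` at `c` and Newton–Puiseux lift `c` to a root `z` after `t = s^l`, which gives the
arc `(s^(lp), s^(lq) z)` (`exists_root_of_mem_newtonSlopes`).

On the polygon side, a compact edge minimizes a form with positive coefficients, for otherwise it
would contain a ray. Such a face is the hull of the exponents on it, so it is an edge exactly when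
there are at least two.

A defining series exists because `x` is a nonzerodivisor modulo `I_Y`, so that Weierstrass division
applies. Finiteness holds because neither variable divides `f`: exponents of `f` on both axes
confine all minimal ones to a box. -/

theorem isAdicComplete_maximalIdeal :
    IsAdicComplete (IsLocalRing.maximalIdeal K⟦X⟧) K⟦X⟧ := by
  rw [maximalIdeal_eq_span_X]; infer_instance

theorem mem_maximalIdeal_iff (a : K⟦X⟧) :
    a ∈ IsLocalRing.maximalIdeal K⟦X⟧ ↔ constantCoeff a = 0 := by
  rw [maximalIdeal_eq_span_X, Ideal.mem_span_singleton, X_dvd_iff]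

theorem residue_eq_zero_iff_constantCoeff (a : K⟦X⟧) :
    IsLocalRing.residue K⟦X⟧ a = 0 ↔ constantCoeff a = 0 := by
  rw [IsLocalRing.residue_eq_zero_iff, mem_maximalIdeal_iff]

/-- The order only depends on which coefficients die; this trades the residue map of `K⟦X⟧` for
`constantCoeff`. -/
theorem order_map_eq_of_forall_eq_zero_iff {A B C : Type*} [Semiring A] [Semiring B] [Semiring C]
    (φ : A →+* B) (ψ : A →+* C) (h : ∀ a, φ a = 0 ↔ ψ a = 0) (g : A⟦X⟧) :
    (g.map φ).order = (g.map ψ).order := by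
  refine le_antisymm (le_order _ _ fun i hi => ?_) (le_order _ _ fun i hi => ?_)
  · rw [coeff_map, ← h, ← coeff_map]; exact coeff_of_lt_order _ hi
  · rw [coeff_map, h, ← coeff_map]; exact coeff_of_lt_order _ hi

theorem map_residue_ne_zero {g : K⟦X⟧⟦X⟧} (hg : g.map constantCoeff ≠ 0) :
    g.map (IsLocalRing.residue K⟦X⟧) ≠ 0 := by
  rw [← order_finite_iff_ne_zero] at hg ⊢
  rwa [order_map_eq_of_forall_eq_zero_iff _ _ residue_eq_zero_iff_constantCoeff]

/-- Weierstrass division over the ring of power series over a field. -/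
theorem exists_eq_mul_add_of_map_constantCoeff_ne_zero {g : K⟦X⟧⟦X⟧}
    (hg : g.map constantCoeff ≠ 0) (f : K⟦X⟧⟦X⟧) :
    ∃ (q : K⟦X⟧⟦X⟧) (r : K⟦X⟧[X]), f = g * q + r ∧
      r.degree < (g.map constantCoeff).order.toNat := by
  have := isAdicComplete_maximalIdeal (K := K)
  obtain ⟨q, r, h⟩ := exists_isWeierstrassDivision f (map_residue_ne_zero hg)
  refine ⟨q, r, h.eq_mul_add, ?_⟩
  rw [order_map_eq_of_forall_eq_zero_iff _ (IsLocalRing.residue K⟦X⟧)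
    fun a => (residue_eq_zero_iff_constantCoeff a).symm]
  exact h.degree_lt

/-- Weierstrass preparation over the ring of power series over a field. -/
theorem exists_eq_distinguished_mul_unit {g : K⟦X⟧⟦X⟧} (hg : g.map constantCoeff ≠ 0) :
    ∃ (w : K⟦X⟧[X]) (u : K⟦X⟧⟦X⟧), w.IsDistinguishedAt (IsLocalRing.maximalIdeal K⟦X⟧) ∧
      IsUnit u ∧ g = w * u := by
  have := isAdicComplete_maximalIdeal (K := K)
  obtain ⟨w, u, h⟩ := exists_isWeierstrassFactorization (map_residue_ne_zero hg)
  exact ⟨w, u, h.isDistinguishedAt, h.isUnit, h.eq_mul⟩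

theorem _root_.Polynomial.IsDistinguishedAt.map_constantCoeff {w : K⟦X⟧[X]}
    (hw : w.IsDistinguishedAt (IsLocalRing.maximalIdeal K⟦X⟧)) :
    w.map constantCoeff = Polynomial.X ^ w.natDegree := by
  ext i
  rw [Polynomial.coeff_map, Polynomial.coeff_X_pow]
  split_ifs with h
  · rw [h, hw.monic.coeff_natDegree, map_one]
  · rcases lt_or_gt_of_ne h with h | h
    · exact (mem_maximalIdeal_iff _).1 (hw.mem h)
    · rw [Polynomial.coeff_eq_zero_of_natDegree_lt h, map_zero]

theorem isDistinguishedAt_of_map_constantCoeff {w : K⟦X⟧[X]} (hm : w.Monic)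
    (h : w.map constantCoeff = Polynomial.X ^ w.natDegree) :
    w.IsDistinguishedAt (IsLocalRing.maximalIdeal K⟦X⟧) where
  monic := hm
  mem {i} hi := by
    rw [mem_maximalIdeal_iff, ← Polynomial.coeff_map, h, Polynomial.coeff_X_pow, if_neg hi.ne]

/-- Polynomials and power series have the same quotient by a distinguished `w`, so divisibility
descends. -/
theorem _root_.Polynomial.IsDistinguishedAt.dvd_of_coe_dvd {A : Type*} [CommRing A] {I : Ideal A}
    [IsAdicComplete I A] {w P : A[X]} (hw : w.IsDistinguishedAt I) (h : (w : A⟦X⟧) ∣ P) :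
    w ∣ P := by
  rw [← Ideal.mem_span_singleton, ← Ideal.Quotient.eq_zero_iff_mem] at h ⊢
  apply hw.algEquivQuotient.injective
  rw [map_zero, ← h]
  simp

/-- A root of the reduction of a polynomial gives a distinguished factor of its translate. -/
theorem exists_distinguished_dvd_comp {P : K⟦X⟧[X]} (hP : P.map constantCoeff ≠ 0) {c : K}
    (hc : (P.map constantCoeff).IsRoot c) :
    ∃ w : K⟦X⟧[X], w.IsDistinguishedAt (IsLocalRing.maximalIdeal K⟦X⟧) ∧ w.natDegree ≠ 0 ∧
      w ∣ P.comp (Polynomial.X + Polynomial.C (C c)) := by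
  set Q := P.comp (Polynomial.X + Polynomial.C (C c)) with hQ
  have hQm : Q.map constantCoeff =
      (P.map constantCoeff).comp (Polynomial.X + Polynomial.C c) := by
    simp [hQ, Polynomial.map_comp]
  have h0 : (Q : K⟦X⟧⟦X⟧).map constantCoeff ≠ 0 := by
    rw [← Polynomial.polynomial_map_coe, hQm]
    intro h
    rw [Polynomial.coe_eq_zero_iff] at h
    exact hP (Polynomial.comp_X_add_C_eq_zero_iff.1 h)
  obtain ⟨w, u, hw, hu, h⟩ := exists_eq_distinguished_mul_unit h0
  have := isAdicComplete_maximalIdeal (K := K)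
  -- In degree zero `w = 1`, and the translate would be a unit although its constant term reduces to
  -- the value of the reduction at its root `c`.
  refine ⟨w, hw, fun hdeg => ?_, hw.dvd_of_coe_dvd ⟨u, h⟩⟩
  have hw1 : w = 1 := Polynomial.eq_one_of_monic_natDegree_zero hw.monic hdeg
  rw [hw1, Polynomial.coe_one, one_mul] at h
  have h1 : IsUnit ((Q : K⟦X⟧⟦X⟧).map constantCoeff) := (h ▸ hu).map _
  rw [← Polynomial.polynomial_map_coe, hQm, isUnit_iff_constantCoeff,
    Polynomial.constantCoeff_coe, Polynomial.coeff_zero_eq_eval_zero] at h1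
  simp [Polynomial.IsRoot.def.1 hc] at h1

/-! ### The Newton–Puiseux theorem. -/

/-- `w` has a root `y(s)` with constant term `c` after a ramified base change `t = s ^ k`. -/
def HasPuiseuxRoot (w : K⟦X⟧[X]) (c : K) : Prop :=
  ∃ (k : ℕ) (hk : k ≠ 0) (z : K⟦X⟧), constantCoeff z = c ∧
    w.eval₂ (expand k hk : K⟦X⟧ →ₐ[K] K⟦X⟧).toRingHom z = 0

namespace HasPuiseuxRoot

theorem of_dvd {v w : K⟦X⟧[X]} {c : K} (h : HasPuiseuxRoot v c) (hvw : v ∣ w) :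
    HasPuiseuxRoot w c := by
  obtain ⟨k, hk, z, hz, h⟩ := h
  obtain ⟨u, rfl⟩ := hvw
  exact ⟨k, hk, z, hz, by rw [Polynomial.eval₂_mul, h, zero_mul]⟩

end HasPuiseuxRoot

theorem eval₂_expand_expand_of_scaled {w Q : K⟦X⟧[X]} {k l r N : ℕ} (hk : k ≠ 0) (hl : l ≠ 0)
    {z : K⟦X⟧}
    (hQ : Polynomial.C (X ^ N) * Q =
      (w.map (expand k hk : K⟦X⟧ →ₐ[K] K⟦X⟧).toRingHom).comp
        (Polynomial.C (X ^ r) * Polynomial.X))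
    (hz : Q.eval₂ (expand l hl : K⟦X⟧ →ₐ[K] K⟦X⟧).toRingHom z = 0) :
    w.eval₂ (expand (l * k) (mul_ne_zero hl hk) : K⟦X⟧ →ₐ[K] K⟦X⟧).toRingHom
      (X ^ (l * r) * z) = 0 := by
  have h := congrArg (Polynomial.eval₂ (expand l hl : K⟦X⟧ →ₐ[K] K⟦X⟧).toRingHom z) hQ
  rw [Polynomial.eval₂_mul, hz, mul_zero, Polynomial.eval₂_comp, Polynomial.eval₂_map] at h
  rw [expand_mul_eq_comp l hl k hk]
  have e : Polynomial.eval₂ (expand l hl : K⟦X⟧ →ₐ[K] K⟦X⟧).toRingHom z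
      (Polynomial.C (X ^ r) * Polynomial.X) = X ^ (l * r) * z := by
    rw [Polynomial.eval₂_mul, Polynomial.eval₂_C, Polynomial.eval₂_X]
    change expand l hl (X ^ r) * z = _
    rw [map_pow, expand_X, pow_mul]
  rw [e] at h
  exact h.symm

/-- The Newton rescaling `w(t^k, t^r Z) = t^N Q(Z)`. Modulo `t`, `Q` retains exactly the terms of
`w` of weight `N`. -/
theorem exists_scaled {w : K⟦X⟧[X]} {k r N : ℕ} (hk : k ≠ 0)
    (h : ∀ i, X ^ N ∣ expand k hk (w.coeff i) * X ^ (r * i)) :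
    ∃ Q : K⟦X⟧[X], Polynomial.C (X ^ N) * Q =
      (w.map (expand k hk : K⟦X⟧ →ₐ[K] K⟦X⟧).toRingHom).comp
        (Polynomial.C (X ^ r) * Polynomial.X) ∧
      (∀ i, X ^ N * Q.coeff i = expand k hk (w.coeff i) * X ^ (r * i)) ∧
      ∀ i, (Q.map constantCoeff).coeff i =
        coeff N (expand k hk (w.coeff i) * X ^ (r * i)) := by
  set W := (w.map (expand k hk : K⟦X⟧ →ₐ[K] K⟦X⟧).toRingHom).comp
    (Polynomial.C (X ^ r) * Polynomial.X) with hW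
  have hc : ∀ i, W.coeff i = expand k hk (w.coeff i) * X ^ (r * i) := fun i => by
    rw [hW, Polynomial.comp_C_mul_X_coeff, Polynomial.coeff_map, ← pow_mul]; rfl
  obtain ⟨Q, hQ⟩ : Polynomial.C (X ^ N) ∣ W :=
    (Polynomial.C_dvd_iff_dvd_coeff _ _).2 fun i => hc i ▸ h i
  have hQi : ∀ i, X ^ N * Q.coeff i = expand k hk (w.coeff i) * X ^ (r * i) := fun i => by
    rw [← hc, hQ, Polynomial.coeff_C_mul]
  refine ⟨Q, hQ.symm, hQi, fun i => ?_⟩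
  rw [← hQi, Polynomial.coeff_map]
  simpa using (coeff_X_pow_mul (Q.coeff i) N 0).symm

namespace HasPuiseuxRoot

theorem of_scaled {w Q : K⟦X⟧[X]} {k r N : ℕ} {c : K} (hk : k ≠ 0) (hr : r ≠ 0)
    (hQ : Polynomial.C (X ^ N) * Q =
      (w.map (expand k hk : K⟦X⟧ →ₐ[K] K⟦X⟧).toRingHom).comp
        (Polynomial.C (X ^ r) * Polynomial.X))
    (h : HasPuiseuxRoot Q c) : HasPuiseuxRoot w 0 := by
  obtain ⟨l, hl, z, -, hz⟩ := h
  exact ⟨l * k, mul_ne_zero hl hk, X ^ (l * r) * z, by simp [hl, hr],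
    eval₂_expand_expand_of_scaled hk hl hQ hz⟩

theorem of_comp_X_add_C {w : K⟦X⟧[X]} {a : K⟦X⟧} {c : K}
    (h : HasPuiseuxRoot (w.comp (Polynomial.X + Polynomial.C a)) c) :
    HasPuiseuxRoot w (c + constantCoeff a) := by
  obtain ⟨k, hk, z, rfl, h⟩ := h
  refine ⟨k, hk, z + expand k hk a, by simp, ?_⟩
  rw [Polynomial.eval₂_comp] at h
  simpa using h

end HasPuiseuxRoot

/-- The inductive step of the Newton–Puiseux algorithm, for a polynomial without subleading term. -/
theorem hasPuiseuxRoot_of_coeff_pred_eq_zero [IsAlgClosed K] [CharZero K] {n : ℕ} (hn : n ≠ 0)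
    (ih : ∀ v : K⟦X⟧[X], v.IsDistinguishedAt (IsLocalRing.maximalIdeal K⟦X⟧) →
      v.natDegree ≠ 0 → v.natDegree < n → HasPuiseuxRoot v 0)
    {w : K⟦X⟧[X]} (hw : w.IsDistinguishedAt (IsLocalRing.maximalIdeal K⟦X⟧))
    (hdeg : w.natDegree = n) (hpred : w.coeff (n - 1) = 0) : HasPuiseuxRoot w 0 := by
  classical
  by_cases h0 : ∀ i < n, w.coeff i = 0
  · refine ⟨1, one_ne_zero, 0, map_zero _, ?_⟩
    rw [Polynomial.eval₂_at_zero, h0 0 (Nat.pos_of_ne_zero hn), map_zero]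
  set S := (Finset.range n).filter fun i => w.coeff i ≠ 0 with hS
  have hmemS : ∀ {i}, i ∈ S ↔ i < n ∧ w.coeff i ≠ 0 := by simp [hS]
  have hSne : S.Nonempty := by
    push Not at h0
    obtain ⟨i, hi⟩ := h0
    exact ⟨i, hmemS.2 hi⟩
  -- The index `j` picks the edge of the Newton polygon of `w` that starts at the leading term; its
  -- slope `r / k` need not be in lowest terms.
  obtain ⟨j, hjS, hmin⟩ := S.exists_min_image
    (fun i => ((w.coeff i).order.toNat : ℚ) / ((n - i : ℕ) : ℚ)) hSne
  obtain ⟨hjn, hj0⟩ := hmemS.1 hjS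
  set r := (w.coeff j).order.toNat with hr
  set k := n - j with hkdef
  have hk : k ≠ 0 := by omega
  have hmin' : ∀ i ∈ S, r * (n - i) ≤ (w.coeff i).order.toNat * k := fun i hi => by
    have h1 := hmin i hi
    have hin := (hmemS.1 hi).1
    rw [div_le_div_iff₀ (by exact_mod_cast Nat.pos_of_ne_zero hk)
      (by exact_mod_cast (by omega : 0 < n - i))] at h1
    exact_mod_cast h1
  have hr0 : r ≠ 0 := by
    have hm : constantCoeff (w.coeff j) = 0 :=
      (mem_maximalIdeal_iff _).1 (hw.mem (hdeg ▸ hjn))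
    intro h
    have := coeff_order hj0
    rw [← hr, h, coeff_zero_eq_constantCoeff] at this
    exact this hm
  have hlead : w.coeff n = 1 := hdeg ▸ hw.monic.coeff_natDegree
  have hgt : ∀ i, n < i → w.coeff i = 0 := fun i hi =>
    Polynomial.coeff_eq_zero_of_natDegree_lt (hdeg ▸ hi)
  have hdvd : ∀ i, (X : K⟦X⟧) ^ (r * n) ∣ expand k hk (w.coeff i) * X ^ (r * i) := fun i => by
    by_cases hi0 : w.coeff i = 0
    · simp [hi0]
    rcases lt_trichotomy i n with hi | rfl | hi
    · have h1 : (X : K⟦X⟧) ^ (k * (w.coeff i).order.toNat) ∣ expand k hk (w.coeff i) := by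
        have := map_dvd (expand k hk : K⟦X⟧ →ₐ[K] K⟦X⟧) (X_pow_order_dvd (φ := w.coeff i))
        rwa [map_pow, expand_X, ← pow_mul] at this
      refine dvd_trans ?_ (mul_dvd_mul_right h1 _)
      rw [← pow_add]
      apply pow_dvd_pow
      have h2 := hmin' i (hmemS.2 ⟨hi, hi0⟩)
      have h3 : r * n = r * (n - i) + r * i := by rw [← mul_add, Nat.sub_add_cancel hi.le]
      rw [h3, mul_comm k]
      omega
    · exact dvd_mul_left _ _
    · exact absurd (hgt i hi) hi0
  obtain ⟨Q, hQ, hQi, hQc⟩ := exists_scaled hk hdvd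
  have hQn : Q.coeff n = 1 := by
    have := hQi n
    rw [hlead, map_one, one_mul] at this
    exact mul_left_cancel₀ (pow_ne_zero _ X_ne_zero) (this.trans (mul_one _).symm)
  have hQgt : ∀ i, n < i → Q.coeff i = 0 := fun i hi => by
    have := hQi i
    rw [hgt i hi, map_zero, zero_mul] at this
    exact (mul_eq_zero.1 this).resolve_left (pow_ne_zero _ X_ne_zero)
  have hQle : Q.natDegree ≤ n := Polynomial.natDegree_le_iff_coeff_eq_zero.2 hQgt
  have hQm : Q.Monic := Polynomial.monic_of_natDegree_le_of_coeff_eq_one n hQle hQn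
  have hQd : Q.natDegree = n :=
    le_antisymm hQle (Polynomial.le_natDegree_of_ne_zero (by simp [hQn]))
  have hhm : (Q.map constantCoeff).Monic := hQm.map _
  have hhd : (Q.map constantCoeff).natDegree = n := by rw [hQm.natDegree_map, hQd]
  have hhpred : (Q.map constantCoeff).coeff (n - 1) = 0 := by rw [hQc, hpred]; simp
  -- The lowest term of `w.coeff j` lies on the chosen edge, so it survives the reduction.
  have hhj : (Q.map constantCoeff).coeff j ≠ 0 := by
    have h3 : r * n = k * r + r * j := by
      rw [mul_comm k, ← mul_add, hkdef, Nat.sub_add_cancel hjn.le]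
    rw [hQc, h3, coeff_mul_X_pow, coeff_expand_mul]
    exact coeff_order hj0
  obtain ⟨c, hc⟩ := IsAlgClosed.exists_root (Q.map constantCoeff) (by
    rw [Polynomial.degree_eq_natDegree hhm.ne_zero, hhd]; exact_mod_cast hn)
  obtain ⟨v, hv, hv0, hvQ⟩ := exists_distinguished_dvd_comp hhm.ne_zero hc
  refine HasPuiseuxRoot.of_scaled (c := c) hk hr0 hQ ?_
  have hQ'm : (Q.comp (Polynomial.X + Polynomial.C (C c))).Monic := hQm.comp_X_add_C _
  have hQ'd : (Q.comp (Polynomial.X + Polynomial.C (C c))).natDegree = n := by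
    rw [Polynomial.natDegree_comp, hQd, Polynomial.natDegree_X_add_C, mul_one]
  have hvle := Polynomial.natDegree_le_of_dvd hvQ hQ'm.ne_zero
  rw [hQ'd] at hvle
  rcases hvle.lt_or_eq with hlt | heq
  · simpa using ((ih v hv hv0 hlt).of_dvd hvQ).of_comp_X_add_C
  -- If the degree does not drop, the reduction of `Q` is `(Z - c)^n`. Its vanishing subleading
  -- coefficient `-nc` forces `c = 0`, contradicting the nonzero coefficient at `j < n`.
  · exfalso
    have hvQ' := Polynomial.eq_of_monic_of_dvd_of_natDegree_le hv.monic hQ'm hvQ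
      (by rw [hQ'd, heq])
    have h1 := hv.map_constantCoeff
    rw [← hvQ', hQ'd, Polynomial.map_comp] at h1
    have h2 := congrArg (fun p => Polynomial.comp p (Polynomial.X - Polynomial.C c)) h1
    simp only [Polynomial.comp_assoc, Polynomial.map_add, Polynomial.map_X, Polynomial.map_C,
      constantCoeff_C, Polynomial.add_comp, Polynomial.X_comp, Polynomial.C_comp,
      sub_add_cancel, Polynomial.comp_X, Polynomial.pow_comp] at h2
    have h3 : c = 0 := by
      have := hhpred
      rw [h2, sub_eq_add_neg, ← Polynomial.C_neg, Polynomial.coeff_X_add_C_pow, Nat.sub_sub_self (Nat.one_le_iff_ne_zero.2 hn),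
        pow_one, Nat.choose_symm (Nat.one_le_iff_ne_zero.2 hn), Nat.choose_one_right] at this
      simpa [hn] using this
    rw [h2, h3, map_zero, sub_zero, Polynomial.coeff_X_pow, if_neg hjn.ne] at hhj
    exact hhj rfl

/-- **Newton–Puiseux theorem**: a distinguished polynomial of positive degree over the ring of
power series over an algebraically closed field of characteristic zero has a root in a ramified
extension. -/
theorem _root_.Polynomial.IsDistinguishedAt.hasPuiseuxRoot [IsAlgClosed K] [CharZero K]
    {w : K⟦X⟧[X]} (hw : w.IsDistinguishedAt (IsLocalRing.maximalIdeal K⟦X⟧))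
    (hdeg : w.natDegree ≠ 0) : HasPuiseuxRoot w 0 := by
  induction hn : w.natDegree using Nat.strong_induction_on generalizing w with
  | _ n ih =>
    rw [hn] at hdeg
    -- Tschirnhaus translation: shifting by `a` kills the subleading coefficient, which needs `n`
    -- invertible in `K`.
    set a : K⟦X⟧ := -(C ((n : K)⁻¹) * w.coeff (n - 1)) with ha
    have hn1 : n - 1 < w.natDegree := by omega
    have ha0 : constantCoeff a = 0 := by
      rw [ha, map_neg, map_mul, (mem_maximalIdeal_iff _).1 (hw.mem hn1), mul_zero, neg_zero]
    set v := w.comp (Polynomial.X + Polynomial.C a) with hv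
    have hvd : v.natDegree = n := by
      rw [hv, Polynomial.natDegree_comp, hn, Polynomial.natDegree_X_add_C, mul_one]
    have hvm : v.Monic := hw.monic.comp_X_add_C a
    have hvdist : v.IsDistinguishedAt (IsLocalRing.maximalIdeal K⟦X⟧) := by
      refine isDistinguishedAt_of_map_constantCoeff hvm ?_
      rw [hvd, hv, Polynomial.map_comp, hw.map_constantCoeff, hn]
      simp [ha0]
    have hpred : v.coeff (n - 1) = 0 := by
      have hlin : (Polynomial.hasseDeriv (n - 1) w).natDegree ≤ 1 :=
        (Polynomial.natDegree_hasseDeriv_le w (n - 1)).trans (by omega)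
      have hlead : w.coeff n = 1 := hn ▸ hw.monic.coeff_natDegree
      have hn0 : (n : K) ≠ 0 := by exact_mod_cast hdeg
      rw [hv, ← Polynomial.taylor_apply, Polynomial.taylor_coeff,
        Polynomial.eq_X_add_C_of_natDegree_le_one hlin, Polynomial.hasseDeriv_coeff,
        Polynomial.hasseDeriv_coeff, show 1 + (n - 1) = n by omega, hlead, zero_add,
        Nat.choose_self, Nat.choose_symm (by omega : 1 ≤ n), Nat.choose_one_right]
      have hC : (n : K⟦X⟧) = C (n : K) := by simp
      simp only [Polynomial.eval_add, Polynomial.eval_mul, Polynomial.eval_C, Polynomial.eval_X,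
        ha, mul_one, Nat.cast_one, one_mul, hC]
      rw [mul_neg, ← mul_assoc, ← map_mul, mul_inv_cancel₀ hn0, map_one, one_mul,
        neg_add_cancel]
    have := hasPuiseuxRoot_of_coeff_pred_eq_zero hdeg
      (fun u hu hu0 hun => ih _ hun hu hu0 rfl) hvdist hvd hpred
    simpa [ha0] using this.of_comp_X_add_C

end PowerSeries

/-! ### The isomorphism `K⟦x⟧⟦y⟧ ≃ K⟦x, y⟧` and principal ideals. -/

namespace MvPowerSeries

open scoped Polynomial PowerSeries

variable (K : Type*) [Field K]

/-- The first variable of `Fin 2` is the inner one, the second variable the outer one. -/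
def optionUnitEquivFinTwo : Option Unit ≃ Fin 2 where
  toFun o := o.elim 1 fun _ => 0
  invFun := ![some (), none]
  left_inv := by rintro (_ | _) <;> rfl
  right_inv i := by fin_cases i <;> rfl

/-- The identification of `K⟦x⟧⟦y⟧` with `K⟦x, y⟧`. -/
noncomputable def iteratedEquiv :
    PowerSeries (PowerSeries K) ≃ₐ[K] MvPowerSeries (Fin 2) K :=
  (optionEquivLeft Unit K).symm.trans (renameEquiv K optionUnitEquivFinTwo)

variable {K}

theorem iteratedEquiv_optionEquivLeft (G : MvPowerSeries (Option Unit) K) :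
    iteratedEquiv K (optionEquivLeft Unit K G) = rename optionUnitEquivFinTwo G := by
  rw [iteratedEquiv, AlgEquiv.trans_apply, AlgEquiv.symm_apply_apply]
  rfl

theorem coeff_iteratedEquiv (F : PowerSeries (PowerSeries K)) (d : Fin 2 →₀ ℕ) :
    coeff d (iteratedEquiv K F) = PowerSeries.coeff (d 0) (PowerSeries.coeff (d 1) F) := by
  obtain ⟨G, rfl⟩ := (optionEquivLeft Unit K).surjective F
  have hd : d = Finsupp.embDomain optionUnitEquivFinTwo.toEmbedding
      ((Finsupp.single () (d 0)).optionElim (d 1)) := by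
    ext i
    fin_cases i
    · exact (Finsupp.embDomain_apply_self optionUnitEquivFinTwo.toEmbedding
        ((Finsupp.single () (d 0)).optionElim (d 1)) (some ())).symm ▸ by simp
    · exact (Finsupp.embDomain_apply_self optionUnitEquivFinTwo.toEmbedding
        ((Finsupp.single () (d 0)).optionElim (d 1)) none).symm ▸ by simp
  rw [PowerSeries.coeff, coeff_coeff_optionEquivLeft, iteratedEquiv_optionEquivLeft]
  conv_lhs => rw [hd]
  exact coeff_embDomain_rename optionUnitEquivFinTwo.toEmbedding G _

theorem iteratedEquiv_C (a : PowerSeries K) :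
    iteratedEquiv K (PowerSeries.C a) = a.toMvPowerSeries 0 := by
  ext d
  rw [coeff_iteratedEquiv, PowerSeries.toMvPowerSeries_eq_subst, PowerSeries.coeff_subst_single,
    PowerSeries.coeff_C]
  have : d = Finsupp.single 0 (d 0) ↔ d 1 = 0 := by
    simp [Finsupp.ext_iff, Fin.forall_fin_two]
  simp only [this]
  split_ifs <;> simp

theorem iteratedEquiv_X : iteratedEquiv K PowerSeries.X = X 1 := by
  rw [← optionEquivLeft_X_none, iteratedEquiv_optionEquivLeft, rename_X]
  rfl

theorem iteratedEquiv_C_X : iteratedEquiv K (PowerSeries.C PowerSeries.X) = X 0 := by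
  rw [iteratedEquiv_C, PowerSeries.toMvPowerSeries_X]

theorem X_zero_dvd_iteratedEquiv_iff (F : PowerSeries (PowerSeries K)) :
    X 0 ∣ iteratedEquiv K F ↔ F.map PowerSeries.constantCoeff = 0 := by
  rw [X_dvd_iff]
  constructor
  · intro h
    ext n
    simpa [coeff_iteratedEquiv] using h (Finsupp.single 1 n) (by simp)
  · intro h d hd
    rw [coeff_iteratedEquiv, hd, PowerSeries.coeff_zero_eq_constantCoeff_apply,
      ← PowerSeries.coeff_map, h, map_zero]

theorem hasSubst_pair {x y : K⟦X⟧} (hx : PowerSeries.constantCoeff x = 0)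
    (hy : PowerSeries.constantCoeff y = 0) :
    HasSubst (![x, y] : Fin 2 → MvPowerSeries Unit K) :=
  hasSubst_of_constantCoeff_zero fun i => by fin_cases i; exacts [hx, hy]

/-- Bridge from Puiseux roots to arcs. Both sides are ring homomorphisms in `w`, so constants and
the variable suffice. -/
theorem subst_iteratedEquiv_coe {k : ℕ} (hk : k ≠ 0) {y : K⟦X⟧}
    (hy : PowerSeries.constantCoeff y = 0) (w : K⟦X⟧[X]) :
    subst (![PowerSeries.X ^ k, y] : Fin 2 → MvPowerSeries Unit K)
      (iteratedEquiv K (w : PowerSeries (PowerSeries K))) =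
      w.eval₂ (PowerSeries.expand k hk : K⟦X⟧ →ₐ[K] K⟦X⟧).toRingHom y := by
  have ha : HasSubst (![PowerSeries.X ^ k, y] : Fin 2 → MvPowerSeries Unit K) :=
    hasSubst_pair (by simp [hk]) hy
  rw [← coe_substAlgHom ha]
  have key : (((substAlgHom ha : MvPowerSeries (Fin 2) K →ₐ[K] MvPowerSeries Unit K) :
      MvPowerSeries (Fin 2) K →+* MvPowerSeries Unit K).comp
        (iteratedEquiv K : PowerSeries (PowerSeries K) →+* MvPowerSeries (Fin 2) K)).comp
        Polynomial.coeToPowerSeries.ringHom =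
      Polynomial.eval₂RingHom
        (PowerSeries.expand k hk : K⟦X⟧ →ₐ[K] K⟦X⟧).toRingHom y := by
    refine Polynomial.ringHom_ext (fun a => ?_) ?_
    · simp [iteratedEquiv_C, PowerSeries.subst_toMvPowerSeries ha, PowerSeries.expand_apply,
        coe_substAlgHom ha]
    · simp [iteratedEquiv_X, subst_X ha]
  exact congrArg (fun φ => φ w) key

/-- An ideal of `K⟦x, y⟧` for which `x` is a nonzerodivisor on the quotient is principal. -/
theorem exists_eq_span_singleton_of_X_mul_mem {I : Ideal (MvPowerSeries (Fin 2) K)}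
    (hI : I ≠ ⊥) (h : ∀ g, X 0 * g ∈ I → g ∈ I) : ∃ f, I = Ideal.span {f} := by
  classical
  -- any nonzero member can be divided by a power of `x`
  have hdiv : ∀ F : PowerSeries (PowerSeries K), F ≠ 0 → iteratedEquiv K F ∈ I →
      ∃ (n : ℕ) (G : PowerSeries (PowerSeries K)), F = PowerSeries.C (PowerSeries.X ^ n) * G ∧
        iteratedEquiv K G ∈ I ∧ G.map PowerSeries.constantCoeff ≠ 0 := by
    intro F hF hFI
    have : IsDomain (MvPowerSeries (Fin 2) K) := NoZeroDivisors.to_isDomain _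
    have : WfDvdMonoid (MvPowerSeries (Fin 2) K) := IsNoetherianRing.wfDvdMonoid
    have hfin : FiniteMultiplicity (X 0) (iteratedEquiv K F) :=
      FiniteMultiplicity.of_not_isUnit (by simp [isUnit_iff_constantCoeff])
        ((map_ne_zero_iff _ (iteratedEquiv K).injective).2 hF)
    obtain ⟨g, hg, hndvd⟩ := hfin.exists_eq_pow_mul_and_not_dvd
    refine ⟨multiplicity (X 0) (iteratedEquiv K F), (iteratedEquiv K).symm g, ?_, ?_, ?_⟩
    · apply (iteratedEquiv K).injective
      rw [map_mul, map_pow, map_pow, iteratedEquiv_C_X, AlgEquiv.apply_symm_apply, ← hg]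
    · rw [AlgEquiv.apply_symm_apply]
      rw [hg] at hFI
      generalize multiplicity (X 0) (iteratedEquiv K F) = n at hFI
      induction n with
      | zero => simpa using hFI
      | succ n ih => exact ih (h _ (by rwa [pow_succ', mul_assoc] at hFI))
    · rwa [ne_eq, ← X_zero_dvd_iteratedEquiv_iff, AlgEquiv.apply_symm_apply]
  have hex : ∃ n, ∃ G : PowerSeries (PowerSeries K), iteratedEquiv K G ∈ I ∧
      G.map PowerSeries.constantCoeff ≠ 0 ∧
      (G.map PowerSeries.constantCoeff).order.toNat = n := by
    obtain ⟨f, hfI, hf⟩ := Submodule.exists_mem_ne_zero_of_ne_bot hI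
    obtain ⟨-, G, -, hG, hG0⟩ := hdiv ((iteratedEquiv K).symm f) (by simpa using hf)
      (by simpa using hfI)
    exact ⟨_, G, hG, hG0, rfl⟩
  -- The generator is a member not divisible by `x` with `G(0, y)` of least order. A nonzero
  -- remainder, stripped of its powers of `x`, would be a member of smaller order.
  obtain ⟨G, hGI, hG0, hGn⟩ := Nat.find_spec hex
  refine ⟨iteratedEquiv K G, le_antisymm (fun f hf => ?_) ?_⟩
  · obtain ⟨q, r, hqr, hr⟩ := PowerSeries.exists_eq_mul_add_of_map_constantCoeff_ne_zero hG0
      ((iteratedEquiv K).symm f)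
    have hf' : f = iteratedEquiv K G * iteratedEquiv K q + iteratedEquiv K r := by
      rw [← map_mul, ← map_add, ← hqr, AlgEquiv.apply_symm_apply]
    by_cases hr0 : r = 0
    · rw [hr0, Polynomial.coe_zero, map_zero, add_zero] at hf'
      exact Ideal.mem_span_singleton.2 ⟨_, hf'⟩
    · exfalso
      have hrI : iteratedEquiv K r ∈ I := by
        rw [show iteratedEquiv K (r : PowerSeries (PowerSeries K)) =
          f - iteratedEquiv K G * iteratedEquiv K q by rw [hf']; ring]
        exact I.sub_mem hf (I.mul_mem_right _ hGI)
      obtain ⟨n, H, hrH, hHI, hH0⟩ := hdiv r (by simpa using hr0) hrI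
      refine Nat.find_min hex (m := (H.map PowerSeries.constantCoeff).order.toNat) ?_
        ⟨H, hHI, hH0, rfl⟩
      rw [← hGn]
      by_contra! hle
      have h1 := PowerSeries.coeff_order hH0
      rw [PowerSeries.coeff_map] at h1
      have h2 : r.coeff (H.map PowerSeries.constantCoeff).order.toNat = 0 :=
        Polynomial.coeff_eq_zero_of_degree_lt (hr.trans_le (by exact_mod_cast hle))
      rw [← Polynomial.coeff_coe, hrH, PowerSeries.coeff_C_mul] at h2
      rw [(mul_eq_zero.1 h2).resolve_left (pow_ne_zero _ PowerSeries.X_ne_zero), map_zero] at h1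
      exact h1 rfl
  · rwa [Ideal.span_singleton_le_iff_mem]

end MvPowerSeries

/-! ### Newton slopes: finiteness, invariance under units, relation to arcs. -/

open MvPowerSeries (iteratedEquiv)
open scoped Polynomial PowerSeries

/-- The `s > 0` for which the weight `(α, β) ↦ α + s β` attains its minimum on the support of `f` at
two distinct exponents. -/
def newtonSlopes (f : MvPowerSeries (Fin 2) ℂ) : Set ℝ :=
  {s | 0 < s ∧ ∃ d e : Fin 2 →₀ ℕ, d ≠ e ∧ MvPowerSeries.coeff d f ≠ 0 ∧
    MvPowerSeries.coeff e f ≠ 0 ∧ (d 0 + s * d 1 : ℝ) = e 0 + s * e 1 ∧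
    ∀ c, MvPowerSeries.coeff c f ≠ 0 → (d 0 + s * d 1 : ℝ) ≤ c 0 + s * c 1}

theorem snd_ne_of_weight_eq {s : ℝ} {d e : Fin 2 →₀ ℕ} (hde : d ≠ e)
    (h : (d 0 + s * d 1 : ℝ) = e 0 + s * e 1) : d 1 ≠ e 1 := by
  intro h1
  rw [h1, add_left_inj, Nat.cast_inj] at h
  exact hde (Finsupp.ext fun i => by fin_cases i <;> assumption)

/-- The support contains some `(a 0, 0)` and `(0, b 1)`. They bound both coordinates of every
exponent of minimal weight, and two such exponents determine `s`. -/
theorem finite_newtonSlopes {f : MvPowerSeries (Fin 2) ℂ} (h0 : ¬ MvPowerSeries.X 0 ∣ f)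
    (h1 : ¬ MvPowerSeries.X 1 ∣ f) : (newtonSlopes f).Finite := by
  rw [MvPowerSeries.X_dvd_iff] at h0 h1
  push Not at h0 h1
  obtain ⟨b, hb0, hb⟩ := h0
  obtain ⟨a, ha0, ha⟩ := h1
  refine ((((Finset.range (a 0 + 1) ×ˢ Finset.range (b 1 + 1)) ×ˢ
    (Finset.range (a 0 + 1) ×ˢ Finset.range (b 1 + 1))).image
      fun v => ((v.1.1 : ℝ) - v.2.1) / ((v.2.2 : ℝ) - v.1.2)).finite_toSet).subset ?_
  rintro s ⟨hs, d, e, hde, -, -, heq, hmin⟩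
  have hbound : ∀ c : Fin 2 →₀ ℕ, (d 0 + s * d 1 : ℝ) = c 0 + s * c 1 →
      c 0 < a 0 + 1 ∧ c 1 < b 1 + 1 := by
    intro c hc
    have hA := hmin a ha
    have hB := hmin b hb
    rw [hc] at hA hB
    rw [ha0] at hA
    rw [hb0] at hB
    have h0 : (0 : ℝ) ≤ c 0 := Nat.cast_nonneg _
    have h1 : (0 : ℝ) ≤ s * c 1 := by positivity
    push_cast at hA hB
    refine ⟨Nat.lt_succ_of_le ?_, Nat.lt_succ_of_le ?_⟩
    · exact_mod_cast (by linarith : (c 0 : ℝ) ≤ a 0)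
    · exact_mod_cast le_of_mul_le_mul_left (by linarith : s * (c 1 : ℝ) ≤ s * b 1) hs
  have hne : ((e 1 : ℝ) - d 1) ≠ 0 :=
    sub_ne_zero.2 (by exact_mod_cast (snd_ne_of_weight_eq hde heq).symm)
  simp only [Finset.coe_image, Set.mem_image, Finset.mem_coe, Finset.mem_product, Finset.mem_range]
  refine ⟨((d 0, d 1), (e 0, e 1)), ⟨hbound d rfl, hbound e heq⟩, ?_⟩
  rw [div_eq_iff hne]
  linarith

/-- Nonconstant terms of `u` strictly raise the weight, so on the minimal line the coefficients of
`f` are just multiplied by the constant term of `u`. -/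
theorem newtonSlopes_subset_mul {f u : MvPowerSeries (Fin 2) ℂ} (hu : IsUnit u) :
    newtonSlopes f ⊆ newtonSlopes (f * u) := by
  classical
  rintro s ⟨hs, d, e, hde, hd, he, heq, hmin⟩
  have hu0 : MvPowerSeries.coeff 0 u ≠ 0 := by
    simpa [isUnit_iff_ne_zero] using MvPowerSeries.isUnit_iff_constantCoeff.1 hu
  have hlow : ∀ c : Fin 2 →₀ ℕ, (c 0 + s * c 1 : ℝ) = d 0 + s * d 1 →
      MvPowerSeries.coeff c f ≠ 0 → MvPowerSeries.coeff c (f * u) ≠ 0 := by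
    intro c hc hcf
    rw [MvPowerSeries.coeff_mul, Finset.sum_eq_single (c, 0)]
    · exact mul_ne_zero hcf hu0
    · rintro ⟨a, b⟩ hab hne
      rw [Finset.HasAntidiagonal.mem_antidiagonal] at hab
      by_contra h0
      have h1 := hmin a (left_ne_zero_of_mul h0)
      rw [← hc, ← hab] at h1
      simp only [Finsupp.add_apply, Nat.cast_add] at h1
      have hb0 : (0 : ℝ) ≤ b 0 := Nat.cast_nonneg _
      have hb1 : (0 : ℝ) ≤ b 1 := Nat.cast_nonneg _
      have hb1' : (0 : ℝ) ≤ s * b 1 := by positivity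
      have e0 : b 0 = 0 := by exact_mod_cast (by linarith : (b 0 : ℝ) = 0)
      have e1 : b 1 = 0 := by
        have := (mul_eq_zero.1 (by linarith : s * (b 1 : ℝ) = 0)).resolve_left hs.ne'
        exact_mod_cast this
      have hb : b = 0 := Finsupp.ext fun i => by fin_cases i <;> assumption
      simp only [hb, add_zero] at hab
      exact hne (by rw [hab, hb])
    · intro h; simp at h
  refine ⟨hs, d, e, hde, hlow d rfl hd, hlow e heq.symm he, heq, fun c hc => ?_⟩
  rw [MvPowerSeries.coeff_mul] at hc
  obtain ⟨⟨a, b⟩, hab, hne⟩ := Finset.exists_ne_zero_of_sum_ne_zero hc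
  rw [Finset.HasAntidiagonal.mem_antidiagonal] at hab
  refine (hmin a (left_ne_zero_of_mul hne)).trans ?_
  rw [← hab]
  simp only [Finsupp.add_apply, Nat.cast_add]
  have hb0 : (0 : ℝ) ≤ b 0 := Nat.cast_nonneg _
  have hb1' : (0 : ℝ) ≤ s * b 1 := by positivity
  linarith

theorem PowerSeries.order_eq_of_X_pow_mul {z : ℂ⟦X⟧} (hz : PowerSeries.constantCoeff z ≠ 0)
    (n : ℕ) : (PowerSeries.X ^ n * z).order = (n : ℕ∞) := by
  have : z.order = 0 := PowerSeries.order_zero_of_unit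
    (PowerSeries.isUnit_iff_constantCoeff.2 (isUnit_iff_ne_zero.2 hz))
  rw [PowerSeries.order_mul, PowerSeries.order_X_pow, this, add_zero]

/-- The initial exponents of an arc on `f = 0` define a Newton slope of `f`: otherwise a single
monomial of `f` would contribute to the initial term of the substitution. -/
theorem div_mem_newtonSlopes_of_subst_eq_zero {f : MvPowerSeries (Fin 2) ℂ} (hf : f ≠ 0)
    {x y : ℂ⟦X⟧} {p q : ℕ} (hx0 : PowerSeries.constantCoeff x = 0)
    (hy0 : PowerSeries.constantCoeff y = 0) (hx : x.order = p) (hy : y.order = q)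
    (h : MvPowerSeries.subst (![x, y] : Fin 2 → MvPowerSeries Unit ℂ) f = 0) :
    (q : ℝ) / p ∈ newtonSlopes f := by
  have hp : 0 < p := by
    have := PowerSeries.order_ne_zero_iff_constCoeff_eq_zero.2 hx0
    rw [hx] at this
    exact Nat.pos_of_ne_zero (by exact_mod_cast this)
  have hq : 0 < q := by
    have := PowerSeries.order_ne_zero_iff_constCoeff_eq_zero.2 hy0
    rw [hy] at this
    exact Nat.pos_of_ne_zero (by exact_mod_cast this)
  have hp' : (0 : ℝ) < p := by exact_mod_cast hp
  have hne : {c | MvPowerSeries.coeff c f ≠ 0}.Nonempty := by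
    by_contra! h0
    exact hf (MvPowerSeries.ext fun c => by
      by_contra hc
      exact (h0 ▸ (show c ∈ {c | MvPowerSeries.coeff c f ≠ 0} from hc) : c ∈ (∅ : Set _)))
  -- The weight of slope `q / p`, cleared of its denominator: `ω c` is the order of `x ^ c 0 * y ^ c
  -- 1`.
  set ω : (Fin 2 →₀ ℕ) → ℕ := fun c => p * c 0 + q * c 1 with hω
  have hscale : ∀ c : Fin 2 →₀ ℕ, (c 0 + (q : ℝ) / p * c 1 : ℝ) = (ω c : ℝ) / p := fun c => by
    rw [hω]; push_cast; field_simp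
  set d := Function.argminOn ω {c | MvPowerSeries.coeff c f ≠ 0} hne with hd
  have hdf : MvPowerSeries.coeff d f ≠ 0 := Function.argminOn_mem ω _ hne
  have hmin : ∀ c, MvPowerSeries.coeff c f ≠ 0 → ω d ≤ ω c := fun c hc =>
    Function.argminOn_le ω {c | MvPowerSeries.coeff c f ≠ 0} hc
  by_contra hnot
  have huniq : ∀ c, c ≠ d → MvPowerSeries.coeff c f ≠ 0 → ω d < ω c := by
    intro c hcd hc
    refine lt_of_le_of_ne (hmin c hc) fun heq => hnot ⟨by positivity, d, c, hcd.symm, hdf, hc, ?_, ?_⟩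
    · rw [hscale, hscale, heq]
    · intro c' hc'
      rw [hscale, hscale]
      have : (ω d : ℝ) ≤ ω c' := by exact_mod_cast hmin c' hc'
      gcongr
  have ha := MvPowerSeries.hasSubst_pair hx0 hy0
  have hord : ∀ c : Fin 2 →₀ ℕ, (x ^ c 0 * y ^ c 1).order = (ω c : ℕ) := fun c => by
    rw [PowerSeries.order_mul, PowerSeries.order_pow, PowerSeries.order_pow, hx, hy, hω]
    simp [mul_comm]
  have hprod : ∀ c : Fin 2 →₀ ℕ,
      (c.prod fun i n => (![x, y] : Fin 2 → MvPowerSeries Unit ℂ) i ^ n) = x ^ c 0 * y ^ c 1 :=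
    fun c => by
      rw [Finsupp.prod_fintype _ _ (fun _ => pow_zero _), Fin.prod_univ_two]; rfl
  have hcoeff := MvPowerSeries.coeff_subst ha f (Finsupp.single () (ω d))
  rw [h, map_zero, finsum_eq_single _ d] at hcoeff
  · rw [hprod] at hcoeff
    refine mul_ne_zero hdf ?_ hcoeff.symm
    exact (PowerSeries.order_eq_nat.1 (hord d)).1
  · intro c hcd
    by_cases hc : MvPowerSeries.coeff c f = 0
    · rw [hc, zero_smul]
    · rw [hprod]
      have : PowerSeries.coeff (ω d) (x ^ c 0 * y ^ c 1) = 0 :=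
        (PowerSeries.order_eq_nat.1 (hord c)).2 _ (huniq c hcd hc)
      exact (congrArg (MvPowerSeries.coeff c f • ·) this).trans (smul_zero _)

/-- Dividing out the power of the variable leaves a nonconstant factor with nonzero constant term.
-/
theorem Polynomial.exists_root_ne_zero_of_two_coeff_ne_zero {K : Type*} [Field K] [IsAlgClosed K]
    {P : K[X]} {i j : ℕ} (hij : i ≠ j) (hi : P.coeff i ≠ 0) (hj : P.coeff j ≠ 0) :
    ∃ c ≠ 0, P.IsRoot c := by
  have hP : P ≠ 0 := by rintro rfl; simp at hi
  obtain ⟨R, hR, hndvd⟩ := P.exists_eq_pow_rootMultiplicity_mul_and_not_dvd hP 0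
  generalize P.rootMultiplicity 0 = n at hR
  rw [Polynomial.C_0, sub_zero] at hR hndvd
  have hdeg : R.degree ≠ 0 := by
    intro h
    rw [Polynomial.eq_C_of_degree_eq_zero h] at hR
    rw [hR, mul_comm, Polynomial.coeff_C_mul_X_pow] at hi hj
    grind
  obtain ⟨c, hc⟩ := IsAlgClosed.exists_root R hdeg
  refine ⟨c, ?_, ?_⟩
  · rintro rfl
    rw [Polynomial.X_dvd_iff, Polynomial.coeff_zero_eq_eval_zero] at hndvd
    exact hndvd hc
  · rw [hR, Polynomial.IsRoot.def, Polynomial.eval_mul, hc.eq_zero, mul_zero]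

/-- Every Newton slope of a polynomial in `y` over `ℂ⟦x⟧` is realized by a parametrized root. -/
theorem exists_root_of_mem_newtonSlopes {w : ℂ⟦X⟧[X]} {s : ℝ}
    (hs : s ∈ newtonSlopes (iteratedEquiv ℂ (w : PowerSeries (PowerSeries ℂ)))) :
    ∃ (p q : ℕ) (hp : p ≠ 0) (y : ℂ⟦X⟧), q ≠ 0 ∧ s = (q : ℝ) / p ∧ y.order = q ∧
      w.eval₂ (PowerSeries.expand p hp : ℂ⟦X⟧ →ₐ[ℂ] ℂ⟦X⟧).toRingHom y = 0 := by
  obtain ⟨hs0, d, e, hde, hd, he, heq, hmin⟩ := hs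
  wlog hlt : d 1 < e 1 generalizing d e
  · exact this e d hde.symm he hd heq.symm (fun c hc => heq ▸ hmin c hc)
      (lt_of_le_of_ne (not_lt.1 hlt) (snd_ne_of_weight_eq hde heq).symm)
  simp only [MvPowerSeries.coeff_iteratedEquiv, Polynomial.coeff_coe] at hd he hmin
  have hlt0 : e 0 < d 0 := by
    have : (d 1 : ℝ) < e 1 := by exact_mod_cast hlt
    have := mul_lt_mul_of_pos_left this hs0
    exact_mod_cast (by linarith : (e 0 : ℝ) < d 0)
  -- The height `p` and width `q` of the segment from `d` to `e` give `s = q / p`, possibly not in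
  -- lowest terms.
  obtain ⟨p, hp, hp0⟩ : ∃ p, e 1 = d 1 + p ∧ p ≠ 0 := ⟨e 1 - d 1, by omega, by omega⟩
  obtain ⟨q, hq, hq0⟩ : ∃ q, d 0 = e 0 + q ∧ q ≠ 0 := ⟨d 0 - e 0, by omega, by omega⟩
  have hp' : (0 : ℝ) < p := by exact_mod_cast Nat.pos_of_ne_zero hp0
  have hsq : s = (q : ℝ) / p := by
    rw [eq_div_iff hp'.ne']
    rw [hq, hp] at heq
    push_cast at heq ⊢
    linarith
  have hcoeff : ∀ m i, PowerSeries.coeff m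
      (PowerSeries.expand p hp0 (w.coeff i) * PowerSeries.X ^ (q * i)) ≠ 0 →
      ∃ j, PowerSeries.coeff j (w.coeff i) ≠ 0 ∧ m = p * j + q * i := by
    intro m i h
    rw [PowerSeries.coeff_mul_X_pow'] at h
    split_ifs at h with h1
    · rw [PowerSeries.coeff_expand] at h
      split_ifs at h with h2
      · exact ⟨_, h, by rw [Nat.mul_div_cancel' h2, Nat.sub_add_cancel h1]⟩
      · exact absurd rfl h
    · exact absurd rfl h
  have hcoeff' : ∀ c : Fin 2 →₀ ℕ, PowerSeries.coeff (p * c 0 + q * c 1)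
      (PowerSeries.expand p hp0 (w.coeff (c 1)) * PowerSeries.X ^ (q * c 1)) =
      PowerSeries.coeff (c 0) (w.coeff (c 1)) := fun c => by
    rw [PowerSeries.coeff_mul_X_pow, PowerSeries.coeff_expand_mul]
  obtain ⟨Q, hQ, -, hQc⟩ := PowerSeries.exists_scaled (w := w) (r := q)
    (N := p * d 0 + q * d 1) hp0 (fun i => by
      rw [PowerSeries.X_pow_dvd_iff]
      intro m hm
      by_contra h
      obtain ⟨j, hj, rfl⟩ := hcoeff m i h
      have h1 := hmin (Finsupp.single 0 j + Finsupp.single 1 i) (by simpa using hj)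
      simp only [Finsupp.add_apply, Finsupp.single_apply, hsq] at h1
      norm_num at h1
      field_simp at h1
      norm_cast at h1
      linarith)
  have hN : p * d 0 + q * d 1 = p * e 0 + q * e 1 := by rw [hp, hq]; ring
  -- The terms at `d` and `e` both have weight `N`, so the reduction of `Q` has nonzero coefficients
  -- in degrees `d 1 ≠ e 1`. That `c ≠ 0` makes the order of the lifted root exact.
  obtain ⟨c, hc0, hc⟩ := Polynomial.exists_root_ne_zero_of_two_coeff_ne_zero
    (P := Q.map PowerSeries.constantCoeff) hlt.ne
    (by rw [hQc, hcoeff']; exact hd) (by rw [hQc, hN, hcoeff']; exact he)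
  have hQ0 : Q.map PowerSeries.constantCoeff ≠ 0 := by
    intro h
    apply hd
    rw [← hcoeff', ← hQc, h, Polynomial.coeff_zero]
  obtain ⟨v, hv, hv0, hvQ⟩ := PowerSeries.exists_distinguished_dvd_comp hQ0 hc
  obtain ⟨l, hl, z, hz, hzQ⟩ := ((hv.hasPuiseuxRoot hv0).of_dvd hvQ).of_comp_X_add_C
  rw [PowerSeries.constantCoeff_C, zero_add] at hz
  refine ⟨l * p, l * q, mul_ne_zero hl hp0, PowerSeries.X ^ (l * q) * z, mul_ne_zero hl hq0, ?_,
    PowerSeries.order_eq_of_X_pow_mul (hz ▸ hc0) _,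
    PowerSeries.eval₂_expand_expand_of_scaled hp0 hl hQ hzQ⟩
  have hl' : (l : ℝ) ≠ 0 := by exact_mod_cast hl
  rw [hsq]
  push_cast
  field_simp

/-! ### Arcs on the curve and its defining series. -/

namespace PlaneCurveSingularity

variable {Y : PlaneCurveSingularity} {f : MvPowerSeries (Fin 2) ℂ}

theorem initialExponentRatios_subset_newtonSlopes (hf : f ∈ Y.ideal) (hf0 : f ≠ 0) :
    Y.initialExponentRatios ⊆ newtonSlopes f := by
  rintro s ⟨x, y, p, q, harc, hx, hy, rfl⟩
  exact div_mem_newtonSlopes_of_subst_eq_zero hf0 harc.constantCoeff_fst harc.constantCoeff_snd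
    hx hy (harc.subst_eq_zero f hf)

theorem newtonSlopes_subset_initialExponentRatios (hY : Y.IsDefiningSeries f)
    (hf : ¬ MvPowerSeries.X 0 ∣ f) : newtonSlopes f ⊆ Y.initialExponentRatios := by
  intro s hs
  obtain ⟨F, rfl⟩ := (iteratedEquiv ℂ).surjective f
  rw [MvPowerSeries.X_zero_dvd_iteratedEquiv_iff] at hf
  obtain ⟨w, u, -, hu, rfl⟩ := PowerSeries.exists_eq_distinguished_mul_unit hf
  obtain ⟨u', huu'⟩ := hu.exists_right_inv
  have hs' : s ∈ newtonSlopes (iteratedEquiv ℂ (w : PowerSeries (PowerSeries ℂ))) := by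
    have hu' : IsUnit (iteratedEquiv ℂ u') :=
      IsUnit.map (iteratedEquiv ℂ) (.of_mul_eq_one u (by rw [mul_comm, huu']))
    have := newtonSlopes_subset_mul hu' hs
    rwa [← map_mul, mul_assoc, huu', mul_one] at this
  obtain ⟨p, q, hp, y, hq, rfl, hy, hroot⟩ := exists_root_of_mem_newtonSlopes hs'
  have hy0 : PowerSeries.constantCoeff y = 0 := by
    rw [← PowerSeries.order_ne_zero_iff_constCoeff_eq_zero, hy]
    exact_mod_cast hq
  have hx0 : PowerSeries.constantCoeff ((PowerSeries.X : ℂ⟦X⟧) ^ p) = 0 := by simp [hp]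
  refine ⟨PowerSeries.X ^ p, y, p, q, ⟨hx0, hy0, fun g hg => ?_⟩, PowerSeries.order_X_pow p, hy,
    rfl⟩
  rw [hY, Ideal.mem_span_singleton] at hg
  obtain ⟨h, rfl⟩ := hg
  have ha := MvPowerSeries.hasSubst_pair hx0 hy0
  rw [map_mul, MvPowerSeries.subst_mul ha, MvPowerSeries.subst_mul ha,
    MvPowerSeries.subst_iteratedEquiv_coe hp hy0, hroot, zero_mul, zero_mul]

/-- A radical ideal is the intersection of its minimal primes, and none of these contains a
variable. -/
theorem mem_ideal_of_X_mul_mem (hY : Y.NoBranchInAxes) (i : Fin 2) {g : MvPowerSeries (Fin 2) ℂ}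
    (hg : MvPowerSeries.X i * g ∈ Y.ideal) : g ∈ Y.ideal := by
  rw [← Y.isRadical.radical, ← Ideal.sInf_minimalPrimes, Submodule.mem_sInf]
  intro P hP
  refine (hP.1.1.mem_or_mem (hP.1.2 hg)).resolve_left fun hX => hY P hP ?_
  fin_cases i
  · exact Ideal.mul_mem_right _ P hX
  · exact Ideal.mul_mem_left P _ hX

/-- Each power series variable raises the dimension by at least one, so the whole ring has dimension
at least two. -/
theorem ideal_ne_bot : Y.ideal ≠ ⊥ := by
  intro h
  have h1 := Y.dim_eq_one
  rw [h, ringKrullDim_eq_of_ringEquiv (RingEquiv.quotientBot _),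
    ← ringKrullDim_eq_of_ringEquiv (iteratedEquiv ℂ).toRingEquiv] at h1
  have h2 := ringKrullDim_succ_le_ringKrullDim_powerseries (R := ℂ)
  have h3 := ringKrullDim_succ_le_ringKrullDim_powerseries (R := ℂ⟦X⟧)
  rw [ringKrullDim_eq_zero_of_field] at h2
  have h4 : (0 + 1 + 1 : WithBot ℕ∞) ≤ 1 := (add_le_add_left h2 1).trans (h3.trans h1.le)
  exact absurd h4 (by decide)

theorem IsDefiningSeries.ne_zero (h : Y.IsDefiningSeries f) : f ≠ 0 := by
  rintro rfl
  exact Y.ideal_ne_bot (h.trans (by simp))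

theorem IsDefiningSeries.not_X_dvd (h : Y.IsDefiningSeries f) (hY : Y.NoBranchInAxes) (i : Fin 2) :
    ¬ MvPowerSeries.X i ∣ f := by
  rintro ⟨g, rfl⟩
  have hg : g ∈ Y.ideal := mem_ideal_of_X_mul_mem hY i (h ▸ Ideal.mem_span_singleton_self _)
  rw [h, Ideal.mem_span_singleton] at hg
  obtain ⟨k, hk⟩ := hg
  have hg0 : g ≠ 0 := right_ne_zero_of_mul h.ne_zero
  -- From `f = X i * g` and `g = f * k`, cancelling `g` would make the variable a unit.
  have : MvPowerSeries.X i * k = 1 :=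
    mul_left_cancel₀ hg0 (by rw [mul_one]; nth_rw 2 [hk]; ring)
  have := congrArg MvPowerSeries.constantCoeff this
  simp at this

theorem exists_isDefiningSeries (hY : Y.NoBranchInAxes) : ∃ f, Y.IsDefiningSeries f :=
  MvPowerSeries.exists_eq_span_singleton_of_X_mul_mem Y.ideal_ne_bot fun _ hg =>
    mem_ideal_of_X_mul_mem hY 0 hg

theorem initialExponentRatios_eq_newtonSlopes (hY : Y.NoBranchInAxes) (h : Y.IsDefiningSeries f) :
    Y.initialExponentRatios = newtonSlopes f :=
  (initialExponentRatios_subset_newtonSlopes (h ▸ Ideal.mem_span_singleton_self f)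
    h.ne_zero).antisymm (newtonSlopes_subset_initialExponentRatios h (h.not_X_dvd hY 0))

end PlaneCurveSingularity

/-! ### Faces of the Newton polygon. -/

/-- A proper convex combination of points with `l ≥ μ` reaches `μ` only if both points do, so the
face of a hull is the hull of the face. -/
theorem mem_convexHull_inter_of_eq {E : Type*} [AddCommGroup E] [Module ℝ E] (l : E →ₗ[ℝ] ℝ)
    {A : Set E} {μ : ℝ} (hA : ∀ v ∈ A, μ ≤ l v) {v : E} (hv : v ∈ convexHull ℝ A) :
    μ ≤ l v ∧ (l v = μ → v ∈ convexHull ℝ (A ∩ {u | l u = μ})) := by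
  have hconv : Convex ℝ {v | μ ≤ l v ∧ (l v = μ → v ∈ convexHull ℝ (A ∩ {u | l u = μ}))} := by
    rw [convex_iff_forall_pos]
    rintro x ⟨hx, hx'⟩ y ⟨hy, hy'⟩ a b ha hb hab
    have h1 : l (a • x + b • y) = a * l x + b * l y := by simp
    have h2 : μ = a * μ + b * μ := by rw [← add_mul, hab, one_mul]
    have h3 := mul_le_mul_of_nonneg_left hx ha.le
    have h4 := mul_le_mul_of_nonneg_left hy hb.le
    refine ⟨by rw [h1]; linarith, fun h => ?_⟩
    have hxe : l x = μ := mul_left_cancel₀ ha.ne' (by linarith)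
    have hye : l y = μ := mul_left_cancel₀ hb.ne' (by linarith)
    exact convex_convexHull ℝ _ (hx' hxe) (hy' hye) ha.le hb.le hab
  refine convexHull_min (fun u hu => ?_) hconv hv
  exact ⟨hA u hu, fun h => subset_convexHull ℝ _ ⟨hu, h⟩⟩

/-- The linear form `(α, β) ↦ a α + b β`. -/
noncomputable def weightForm (a b : ℝ) : ℝ × ℝ →L[ℝ] ℝ :=
  a • ContinuousLinearMap.fst ℝ ℝ ℝ + b • ContinuousLinearMap.snd ℝ ℝ ℝ

@[simp]
theorem weightForm_apply (a b : ℝ) (v : ℝ × ℝ) : weightForm a b v = a * v.1 + b * v.2 := rfl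

section NewtonPolygon

variable {f : MvPowerSeries (Fin 2) ℂ}

/-- The set `supp f + ℝ²_{≥ 0}`. -/
def upperSupport (f : MvPowerSeries (Fin 2) ℂ) : Set (ℝ × ℝ) :=
  {v | ∃ d : Fin 2 →₀ ℕ, MvPowerSeries.coeff d f ≠ 0 ∧ (d 0 : ℝ) ≤ v.1 ∧ (d 1 : ℝ) ≤ v.2}

theorem mem_newtonPolygon_of_coeff_ne_zero {d : Fin 2 →₀ ℕ} (hd : MvPowerSeries.coeff d f ≠ 0) :
    ((d 0, d 1) : ℝ × ℝ) ∈ newtonPolygon f :=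
  subset_convexHull ℝ (upperSupport f) ⟨d, hd, le_rfl, le_rfl⟩

theorem add_mem_newtonPolygon {v u : ℝ × ℝ} (hv : v ∈ newtonPolygon f) (hu : 0 ≤ u) :
    u + v ∈ newtonPolygon f := by
  have hconv : Convex ℝ ((fun z => u + z) ⁻¹' newtonPolygon f) :=
    (convex_convexHull ℝ (upperSupport f)).translate_preimage_right u
  refine convexHull_min (t := (fun z => u + z) ⁻¹' newtonPolygon f) ?_ hconv hv
  rintro z ⟨d, hd, h0, h1⟩
  refine subset_convexHull ℝ (upperSupport f) ⟨d, hd, ?_, ?_⟩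
  · exact h0.trans (le_add_of_nonneg_left hu.1)
  · exact h1.trans (le_add_of_nonneg_left hu.2)

theorem le_weightForm_of_mem_upperSupport {a b μ : ℝ} (ha : 0 ≤ a) (hb : 0 ≤ b)
    (h : ∀ c : Fin 2 →₀ ℕ, MvPowerSeries.coeff c f ≠ 0 → μ ≤ a * c 0 + b * c 1)
    {v : ℝ × ℝ} (hv : v ∈ upperSupport f) : μ ≤ weightForm a b v := by
  obtain ⟨d, hd, h0, h1⟩ := hv
  have := h d hd
  have := mul_le_mul_of_nonneg_left h0 ha
  have := mul_le_mul_of_nonneg_left h1 hb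
  rw [weightForm_apply]
  linarith

theorem exists_coeff_of_mem_upperSupport_of_eq {a b μ : ℝ} (ha : 0 < a) (hb : 0 < b)
    (h : ∀ c : Fin 2 →₀ ℕ, MvPowerSeries.coeff c f ≠ 0 → μ ≤ a * c 0 + b * c 1)
    {v : ℝ × ℝ} (hv : v ∈ upperSupport f) (hμ : weightForm a b v = μ) :
    ∃ d : Fin 2 →₀ ℕ, MvPowerSeries.coeff d f ≠ 0 ∧ v = ((d 0 : ℝ), (d 1 : ℝ)) := by
  obtain ⟨d, hd, h0, h1⟩ := hv
  have h2 := h d hd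
  have h3 := mul_le_mul_of_nonneg_left h0 ha.le
  have h4 := mul_le_mul_of_nonneg_left h1 hb.le
  rw [weightForm_apply] at hμ
  refine ⟨d, hd, Prod.ext ?_ ?_⟩
  · exact mul_left_cancel₀ ha.ne' (by linarith)
  · exact mul_left_cancel₀ hb.ne' (by linarith)

/-- A supporting line of positive slopes cuts a compact edge out of the Newton polygon as soon as
it contains two exponents of the support. -/
theorem isCompactEdge_of_mem_newtonSlopes {s : ℝ} (hs : 0 < s) {d e : Fin 2 →₀ ℕ} (hde : d ≠ e)
    (hd : MvPowerSeries.coeff d f ≠ 0) (he : MvPowerSeries.coeff e f ≠ 0)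
    (heq : (d 0 + s * d 1 : ℝ) = e 0 + s * e 1)
    (hmin : ∀ c, MvPowerSeries.coeff c f ≠ 0 → (d 0 + s * d 1 : ℝ) ≤ c 0 + s * c 1) :
    IsCompactEdge (newtonPolygon f)
      {v ∈ newtonPolygon f | weightForm 1 s v = d 0 + s * d 1} := by
  set μ : ℝ := d 0 + s * d 1 with hμ
  have hmin' : ∀ c : Fin 2 →₀ ℕ, MvPowerSeries.coeff c f ≠ 0 → μ ≤ 1 * c 0 + s * c 1 :=
    fun c hc => by rw [one_mul]; exact hmin c hc
  have hle : ∀ v ∈ newtonPolygon f, μ ≤ weightForm 1 s v := fun v hv =>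
    (mem_convexHull_inter_of_eq (weightForm 1 s).toLinearMap
      (fun u hu => le_weightForm_of_mem_upperSupport zero_le_one hs.le hmin' hu) hv).1
  have hdE : ((d 0, d 1) : ℝ × ℝ) ∈ {v ∈ newtonPolygon f | weightForm 1 s v = μ} :=
    ⟨mem_newtonPolygon_of_coeff_ne_zero hd, by simp [hμ]⟩
  have heE : ((e 0, e 1) : ℝ × ℝ) ∈ {v ∈ newtonPolygon f | weightForm 1 s v = μ} :=
    ⟨mem_newtonPolygon_of_coeff_ne_zero he, by simp [heq]⟩
  refine ⟨fun _ => ⟨-weightForm 1 s, ?_⟩, ?_, ?_⟩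
  · ext v
    refine ⟨fun ⟨hv, hvμ⟩ => ⟨hv, fun u hu => ?_⟩, fun ⟨hv, hmax⟩ => ⟨hv, ?_⟩⟩
    · simpa [hvμ] using neg_le_neg (hle u hu)
    · have h1 := hmax _ hdE.1
      rw [neg_apply, neg_apply, hdE.2, neg_le_neg_iff] at h1
      exact h1.antisymm (hle v hv)
  -- As both weights are positive, the minimal line meets `upperSupport f` only in exponents,
  -- finitely many; the face is their hull.
  · have hfin : (upperSupport f ∩ {u | (weightForm 1 s).toLinearMap u = μ}).Finite := by
      refine ((((Set.finite_Iic ⌊μ⌋₊).prod (Set.finite_Iic ⌊μ / s⌋₊)).image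
        fun v : ℕ × ℕ => ((v.1 : ℝ), (v.2 : ℝ)))).subset ?_
      rintro v ⟨hv, hvμ⟩
      obtain ⟨c, -, rfl⟩ := exists_coeff_of_mem_upperSupport_of_eq one_pos hs hmin' hv hvμ
      have hvμ' : (c 0 : ℝ) + s * c 1 = μ := by simpa using hvμ
      refine ⟨(c 0, c 1), ⟨Nat.le_floor ?_, Nat.le_floor ?_⟩, rfl⟩
      · have : (0 : ℝ) ≤ s * c 1 := by positivity
        linarith
      · have : (0 : ℝ) ≤ c 0 := Nat.cast_nonneg _
        rw [le_div_iff₀ hs]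
        linarith
    have hE : {v ∈ newtonPolygon f | weightForm 1 s v = μ} =
        convexHull ℝ (upperSupport f ∩ {u | (weightForm 1 s).toLinearMap u = μ}) := by
      refine Set.Subset.antisymm (fun v ⟨hv, hvμ⟩ => ?_) (fun v hv => ?_)
      · exact (mem_convexHull_inter_of_eq (weightForm 1 s).toLinearMap
          (fun u hu => le_weightForm_of_mem_upperSupport zero_le_one hs.le hmin' hu) hv).2 hvμ
      · refine ⟨convexHull_mono Set.inter_subset_left hv, ?_⟩
        exact convexHull_min (t := {u | (weightForm 1 s).toLinearMap u = μ}) Set.inter_subset_right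
          (convex_hyperplane (weightForm 1 s).toLinearMap.isLinear μ) hv
    rw [hE]
    exact hfin.isCompact_convexHull ℝ
  · have hsub : vectorSpan ℝ {v ∈ newtonPolygon f | weightForm 1 s v = μ} ≤
        Submodule.span ℝ {((-s, 1) : ℝ × ℝ)} := by
      rw [vectorSpan_def, Submodule.span_le]
      rintro _ ⟨u, ⟨-, hu⟩, v, ⟨-, hv⟩, rfl⟩
      rw [weightForm_apply] at hu hv
      refine Submodule.mem_span_singleton.2 ⟨u.2 - v.2, Prod.ext ?_ ?_⟩
      · simp only [Prod.smul_mk, vsub_eq_sub, Prod.fst_sub, smul_eq_mul]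
        linarith
      · simp
    refine le_antisymm ((Submodule.finrank_mono hsub).trans (finrank_span_singleton (by simp)).le) ?_
    have hmem := vsub_mem_vectorSpan ℝ hdE heE
    have hne : ((d 0, d 1) : ℝ × ℝ) -ᵥ (e 0, e 1) ≠ 0 := by
      rw [vsub_eq_sub, sub_ne_zero]
      intro h
      exact snd_ne_of_weight_eq hde heq (Nat.cast_injective (congrArg Prod.snd h))
    have : Nontrivial (vectorSpan ℝ {v ∈ newtonPolygon f | weightForm 1 s v = μ}) :=
      ⟨⟨_, hmem⟩, 0, fun h => hne (congrArg Subtype.val h)⟩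
    exact Module.finrank_pos

theorem newtonSlopes_subset_orthogonalRaySlopes :
    newtonSlopes f ⊆ orthogonalRaySlopes (newtonPolygon f) := by
  rintro s ⟨hs, d, e, hde, hd, he, heq, hmin⟩
  refine ⟨_, (1, s), isCompactEdge_of_mem_newtonSlopes hs hde hd he heq hmin, by simp,
    zero_le_one, hs.le, ?_, by simp⟩
  rintro a ⟨-, ha⟩ b ⟨-, hb⟩
  rw [weightForm_apply] at ha hb
  linarith

/-- A compact edge of a Newton polygon is cut out by a form with positive coefficients. -/
theorem IsCompactEdge.exists_weightForm {E : Set (ℝ × ℝ)}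
    (hE : IsCompactEdge (newtonPolygon f) E) :
    ∃ a b μ : ℝ, 0 < a ∧ 0 < b ∧ (∀ v ∈ newtonPolygon f, μ ≤ weightForm a b v) ∧
      E = {v ∈ newtonPolygon f | weightForm a b v = μ} := by
  have hne : E.Nonempty := by
    by_contra! h
    have := hE.finrank_eq_one
    rw [h, vectorSpan_empty, finrank_bot] at this
    exact zero_ne_one this
  obtain ⟨l, hl⟩ := hE.isExposed hne
  obtain ⟨e, heE⟩ := hne
  have heE' := heE
  rw [hl] at heE'
  have hform : ∀ v, l v = -weightForm (-l (1, 0)) (-l (0, 1)) v := fun v => by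
    have : v = v.1 • ((1, 0) : ℝ × ℝ) + v.2 • ((0, 1) : ℝ × ℝ) := by ext <;> simp
    rw [weightForm_apply]
    nth_rw 1 [this]
    rw [map_add, map_smul, map_smul, smul_eq_mul, smul_eq_mul]
    ring
  -- moving in a direction of the quadrant strictly increases the form
  have hpos : ∀ u : ℝ × ℝ, 0 ≤ u → u ≠ 0 → 0 < -l u := by
    intro u hu hu0
    have hle : l u ≤ 0 := by
      have := heE'.2 _ (add_mem_newtonPolygon heE'.1 hu)
      rw [map_add] at this
      linarith
    rw [neg_pos]
    refine lt_of_le_of_ne hle fun h0 => ?_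
    -- If `l u = 0`, then `E` contains a ray in direction `u`, on which the coordinate sum is
    -- unbounded, against compactness.
    have hray : ∀ t : ℝ, 0 ≤ t → t • u + e ∈ E := fun t ht => by
      rw [hl]
      refine ⟨add_mem_newtonPolygon heE'.1 (smul_nonneg ht hu), fun v hv => ?_⟩
      rw [map_add, map_smul, h0, smul_zero, zero_add]
      exact heE'.2 v hv
    obtain ⟨M, hM⟩ := (hE.isCompact.image (weightForm 1 1).continuous).bddAbove
    have hu1 : 0 < weightForm 1 1 u := by
      rw [weightForm_apply, one_mul, one_mul]
      have h1 : 0 ≤ u.1 := hu.1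
      have h2 : 0 ≤ u.2 := hu.2
      refine lt_of_le_of_ne (add_nonneg h1 h2) fun h => hu0 (Prod.ext ?_ ?_) <;>
      simp <;> linarith
    have hMe : weightForm 1 1 e ≤ M := hM ⟨e, heE, rfl⟩
    have := hM ⟨_, hray ((M - weightForm 1 1 e + 1) / weightForm 1 1 u)
      (div_nonneg (by linarith) hu1.le), rfl⟩
    rw [map_add, map_smul, smul_eq_mul, div_mul_cancel₀ _ hu1.ne'] at this
    linarith
  refine ⟨-l (1, 0), -l (0, 1), -l e, hpos _ (by simp [Prod.le_def]) (by simp),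
    hpos _ (by simp [Prod.le_def]) (by simp), fun v hv => ?_, ?_⟩
  · have h1 := heE'.2 v hv
    have h2 := hform v
    linarith
  · ext v
    rw [hl]
    refine and_congr_right fun hv => ⟨fun h => ?_, fun h u hu => ?_⟩
    · have h1 := h e heE'.1
      have h2 := heE'.2 v hv
      have h3 := hform v
      linarith
    · have h2 := heE'.2 u hu
      have h3 := hform v
      linarith

theorem orthogonalRaySlopes_subset_newtonSlopes :
    orthogonalRaySlopes (newtonPolygon f) ⊆ newtonSlopes f := by
  rintro s ⟨E, w, hE, hw, -, -, horth, hws⟩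
  obtain ⟨a, b, μ, ha, hb, hle, rfl⟩ := hE.exists_weightForm
  have hmin : ∀ c : Fin 2 →₀ ℕ, MvPowerSeries.coeff c f ≠ 0 → μ ≤ a * c 0 + b * c 1 :=
    fun c hc => hle _ (mem_newtonPolygon_of_coeff_ne_zero hc)
  -- With at most one exponent on the line, the face would be at most a point.
  have hntr : (upperSupport f ∩ {u | (weightForm a b).toLinearMap u = μ}).Nontrivial := by
    by_contra hsub
    rw [Set.not_nontrivial_iff] at hsub
    have hEsub : {v ∈ newtonPolygon f | weightForm a b v = μ}.Subsingleton := by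
      refine hsub.anti fun v ⟨hv, hvμ⟩ => ?_
      have := (mem_convexHull_inter_of_eq (weightForm a b).toLinearMap
        (fun u hu => le_weightForm_of_mem_upperSupport ha.le hb.le hmin hu) hv).2 hvμ
      rwa [hsub.convex.convexHull_eq] at this
    have := hE.finrank_eq_one
    rw [vectorSpan_of_subsingleton _ hEsub, finrank_bot] at this
    exact zero_ne_one this
  obtain ⟨u, ⟨hu, huμ⟩, v, ⟨hv, hvμ⟩, huv⟩ := hntr
  obtain ⟨d, hd, rfl⟩ := exists_coeff_of_mem_upperSupport_of_eq ha hb hmin hu huμ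
  obtain ⟨e, he, rfl⟩ := exists_coeff_of_mem_upperSupport_of_eq ha hb hmin hv hvμ
  have hort := horth _ ⟨mem_newtonPolygon_of_coeff_ne_zero hd, huμ⟩ _
    ⟨mem_newtonPolygon_of_coeff_ne_zero he, hvμ⟩
  have hdμ : a * (d 0 : ℝ) + b * d 1 = μ := huμ
  have heμ : a * (e 0 : ℝ) + b * e 1 = μ := hvμ
  have hw1 : w.1 ≠ 0 := fun h => hw (Prod.ext h (by rw [hws, h, mul_zero]; rfl))
  have hort' : ((d 0 : ℝ) - e 0) + s * (d 1 - e 1) = 0 := by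
    rw [hws] at hort
    exact (mul_eq_zero.1 (by linarith :
      w.1 * (((d 0 : ℝ) - e 0) + s * (d 1 - e 1)) = 0)).resolve_left hw1
  have hde : d ≠ e := by rintro rfl; exact huv rfl
  have hd1 : (d 1 : ℝ) - e 1 ≠ 0 := sub_ne_zero.2 (by
    exact_mod_cast snd_ne_of_weight_eq (s := s) hde (by linarith))
  -- Both `(a, b)` and `(1, s)` are orthogonal to `d - e`, whose second coordinate is nonzero, so
  -- they are proportional.
  have hs : b = a * s := by
    refine mul_right_cancel₀ hd1 ?_
    linear_combination hdμ - heμ - a * hort'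
  subst hs
  refine ⟨pos_of_mul_pos_right hb ha.le, d, e, hde, hd, he, by linarith, fun c hc => ?_⟩
  refine le_of_mul_le_mul_left ?_ ha
  have := hmin c hc
  linarith

theorem orthogonalRaySlopes_newtonPolygon :
    orthogonalRaySlopes (newtonPolygon f) = newtonSlopes f :=
  orthogonalRaySlopes_subset_newtonSlopes.antisymm newtonSlopes_subset_orthogonalRaySlopes

end NewtonPolygon

theorem theorem3p5 (Y : PlaneCurveSingularity) (hY : Y.NoBranchInAxes) :
    Y.initialExponentRatios.Finite ∧
      (∃ f : MvPowerSeries (Fin 2) ℂ, Y.IsDefiningSeries f) ∧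
      ∀ f : MvPowerSeries (Fin 2) ℂ, Y.IsDefiningSeries f →
        Y.initialExponentRatios = orthogonalRaySlopes (newtonPolygon f) := by
  refine ⟨?_, PlaneCurveSingularity.exists_isDefiningSeries hY, fun f hf => ?_⟩
  · obtain ⟨f, hf⟩ := PlaneCurveSingularity.exists_isDefiningSeries hY
    rw [PlaneCurveSingularity.initialExponentRatios_eq_newtonSlopes hY hf]
    exact finite_newtonSlopes (hf.not_X_dvd hY 0) (hf.not_X_dvd hY 1)
  · rw [PlaneCurveSingularity.initialExponentRatios_eq_newtonSlopes hY hf,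
      orthogonalRaySlopes_newtonPolygon]
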